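/- **Equipartition of the energy.** Let $\mathcal M_\infty$ be the set of finite positive Borel measures $\mu$ on $(-1,1)\times\mathbb R$ (with variables $(x,k)$) such that $\mu((-1,0]\times\mathbb R)=0$, the distributional derivative $\mu_{,x}$, given by $\langle\mu_{,x},\varphi\rangle=-\int \varphi_{,x}\,d\mu$ for $\varphi\in C_c^\infty((-1,1)\times\mathbb R)$, is a bounded signed measure on $(-1,1)\times\mathbb R$ with $\mu_{,x}\ll\mu$, and $$\int_{(0,1)\times\mathbb R}\phi(x)\,d\mu(x,k)=\int_0^1 2x\,\phi(x)\,dx\qquad\text{for all }\phi\in C_c^\infty(0,1).$$ For $\mu\in\mathcal M_\infty$ put $$\mathcal F_\infty(\mu)=\int_{(0,1)\times\mathbb R}\Big[k^2+\frac1{4k^2}\Big(\frac{d\mu_{,x}}{d\mu}\Big)^2\Big]d\mu\in[0,+\infty],$$ where for $k=0$ the second term in the bracket is read as $+\infty$ if $\frac{d\mu_{,x}}{d\mu}\neq0$ and as $0$ if $\frac{d\mu_{,x}}{d\mu}=0$. If $\hat\mu\in\mathcal M_\infty$ minimizes $\mathcal F_\infty$, that is, $\mathcal F_\infty(\hat\mu)\le\mathcal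 F_\infty(\mu)$ for all $\mu\in\mathcal M_\infty$, then $$\int_{(0,1)\times\mathbb R}k^2\,d\hat\mu=\int_{(0,1)\times\mathbb R}\frac1{4k^2}\Big(\frac{d\hat\mu_{,x}}{d\hat\mu}\Big)^2d\hat\mu<+\infty .$$ -/

import Mathlib

open MeasureTheory Set
open scoped ENNReal ContDiff

noncomputable section

namespace WrinkleLimit

/-- The open strip `(-1,1) × ℝ` with coordinates `(x, k)`. Measures on the strip are represented
by measures on `ℝ × ℝ` that are concentrated on it. -/
def strip : Set (ℝ × ℝ) := Ioo (-1) 1 ×ˢ univ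

/-- The half strip `(0,1) × ℝ`. -/
def halfStrip : Set (ℝ × ℝ) := Ioo 0 1 ×ˢ univ

/-- The class `C_c^∞(U)`: smooth real functions with compact support contained in `U`. -/
structure IsTestFunction {E : Type*} [NormedAddCommGroup E] [NormedSpace ℝ E]
    (U : Set E) (φ : E → ℝ) : Prop where
  contDiff : ContDiff ℝ ∞ φ
  hasCompactSupport : HasCompactSupport φ
  tsupport_subset : tsupport φ ⊆ U

/-- The integral of a function against a finite signed measure (through its Jordan
decomposition). -/
def signedIntegral (ν : SignedMeasure (ℝ × ℝ)) (φ : ℝ × ℝ → ℝ) : ℝ :=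
  (∫ p, φ p ∂ν.toJordanDecomposition.posPart) - ∫ p, φ p ∂ν.toJordanDecomposition.negPart

/-- `ν` is a bounded signed measure on the strip that represents the distributional derivative
`μ_{,x}` of `μ` on the strip: `∫ φ dν = - ∫ φ_{,x} dμ` for all `φ ∈ C_c^∞((-1,1) × ℝ)`. -/
structure IsXDeriv (μ : Measure (ℝ × ℝ)) (ν : SignedMeasure (ℝ × ℝ)) : Prop where
  concentrated : ∀ s, MeasurableSet s → Disjoint s strip → ν s = 0
  integral_eq : ∀ φ : ℝ × ℝ → ℝ, IsTestFunction strip φ →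
    signedIntegral ν φ = -∫ p in strip, deriv (fun t => φ (t, p.2)) p.1 ∂μ

/-- A distribution is represented by at most one bounded measure. -/
theorem IsXDeriv.unique {μ : Measure (ℝ × ℝ)} {ν₁ ν₂ : SignedMeasure (ℝ × ℝ)}
    (h₁ : IsXDeriv μ ν₁) (h₂ : IsXDeriv μ ν₂) : ν₁ = ν₂ := by
  have hopen : IsOpen strip := isOpen_Ioo.prod isOpen_univ
  have hmeas : MeasurableSet strip := hopen.measurableSet
  set p₁ := ν₁.toJordanDecomposition.posPart with hp₁
  set n₁ := ν₁.toJordanDecomposition.negPart with hn₁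
  set p₂ := ν₂.toJordanDecomposition.posPart with hp₂
  set n₂ := ν₂.toJordanDecomposition.negPart with hn₂
  have val : ∀ (ν : SignedMeasure (ℝ × ℝ)) (s : Set (ℝ × ℝ)), MeasurableSet s →
      ν s = ν.toJordanDecomposition.posPart.real s - ν.toJordanDecomposition.negPart.real s := by
    intro ν s hs
    conv_lhs => rw [← ν.toSignedMeasure_toJordanDecomposition]
    rw [JordanDecomposition.toSignedMeasure, sub_apply,
      Measure.toSignedMeasure_apply_measurable hs, Measure.toSignedMeasure_apply_measurable hs]
  let m : Measure (ℝ × ℝ) := p₁ + n₁ + p₂ + n₂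
  have hle : ∀ q ∈ [p₁, n₁, p₂, n₂], q ≤ m := by
    intro q hq
    refine Measure.le_iff.2 fun s _ => ?_
    simp only [List.mem_cons, List.not_mem_nil, or_false] at hq
    simp only [m, Measure.add_apply]
    rcases hq with rfl | rfl | rfl | rfl
    · exact (le_add_right (le_add_right le_self_add))
    · exact (le_add_right (le_add_right le_add_self))
    · exact (le_add_right le_add_self)
    · exact le_add_self
  have ac : ∀ q ∈ [p₁, n₁, p₂, n₂], q ≪ m := fun q hq => (hle q hq).absolutelyContinuous
  have a1 := ac p₁ (by simp)
  have a2 := ac n₁ (by simp)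
  have a3 := ac p₂ (by simp)
  have a4 := ac n₂ (by simp)
  let f : ℝ × ℝ → ℝ := fun z => ((p₁.rnDeriv m z).toReal - (n₁.rnDeriv m z).toReal) -
    ((p₂.rnDeriv m z).toReal - (n₂.rnDeriv m z).toReal)
  have i1 : Integrable (fun z => (p₁.rnDeriv m z).toReal) m := Measure.integrable_toReal_rnDeriv
  have i2 : Integrable (fun z => (n₁.rnDeriv m z).toReal) m := Measure.integrable_toReal_rnDeriv
  have i3 : Integrable (fun z => (p₂.rnDeriv m z).toReal) m := Measure.integrable_toReal_rnDeriv
  have i4 : Integrable (fun z => (n₂.rnDeriv m z).toReal) m := Measure.integrable_toReal_rnDeriv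
  have hf : Integrable f m := (i1.sub i2).sub (i3.sub i4)
  have key : ∀ᵐ z ∂m, z ∈ strip → f z = 0 := by
    refine hopen.ae_eq_zero_of_integral_contDiff_smul_eq_zero
      (hf.locallyIntegrable.locallyIntegrableOn _) ?_
    intro g hg hgc hgs
    have e₁ := h₁.integral_eq g ⟨hg, hgc, hgs⟩
    have e₂ := h₂.integral_eq g ⟨hg, hgc, hgs⟩
    have e : signedIntegral ν₁ g = signedIntegral ν₂ g := e₁.trans e₂.symm
    obtain ⟨C, hC⟩ := hgc.exists_bound_of_continuous hg.continuous
    have b : ∀ {w : ℝ × ℝ → ℝ}, Integrable w m → Integrable (fun z => w z • g z) m := by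
      intro w hw
      exact hw.mul_bdd hg.continuous.aestronglyMeasurable (Filter.Eventually.of_forall hC)
    unfold signedIntegral at e
    rw [← hp₁, ← hn₁, ← hp₂, ← hn₂, ← integral_rnDeriv_smul a1, ← integral_rnDeriv_smul a2,
      ← integral_rnDeriv_smul a3, ← integral_rnDeriv_smul a4, ← integral_sub (b i1) (b i2),
      ← integral_sub (b i3) (b i4)] at e
    have e' := sub_eq_zero.2 e
    have e'' := integral_sub ((b i1).sub (b i2)) ((b i3).sub (b i4))
    refine Eq.trans ?_ (e''.trans e')
    refine integral_congr_ae (Filter.Eventually.of_forall fun z => ?_)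
    simp only [f, smul_eq_mul, Pi.sub_apply]
    ring
  have onStrip : ∀ s, MeasurableSet s → s ⊆ strip → ν₁ s = ν₂ s := by
    intro s hs hss
    rw [val ν₁ s hs, val ν₂ s hs, ← hp₁, ← hn₁, ← hp₂, ← hn₂,
      ← Measure.setIntegral_toReal_rnDeriv a1, ← Measure.setIntegral_toReal_rnDeriv a2,
      ← Measure.setIntegral_toReal_rnDeriv a3, ← Measure.setIntegral_toReal_rnDeriv a4,
      ← integral_sub i1.integrableOn i2.integrableOn,
      ← integral_sub i3.integrableOn i4.integrableOn]
    refine setIntegral_congr_ae hs ?_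
    filter_upwards [key] with z hz hzs
    exact sub_eq_zero.1 (hz (hss hzs))
  ext s hs
  have split : ∀ ν : SignedMeasure (ℝ × ℝ), ν s = ν (s ∩ strip) + ν (s \ strip) := by
    intro ν
    rw [← VectorMeasure.of_union (disjoint_sdiff_inter.symm) (hs.inter hmeas) (hs.diff hmeas),
      inter_union_sdiff]
  rw [split ν₁, split ν₂, onStrip _ (hs.inter hmeas) inter_subset_right,
    h₁.concentrated _ (hs.diff hmeas) disjoint_sdiff_left,
    h₂.concentrated _ (hs.diff hmeas) disjoint_sdiff_left]

/-- The distributional derivative `μ_{,x}` of `μ` on the strip; meaningful when it is a bounded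
measure, i.e. when some `ν` with `IsXDeriv μ ν` exists (such a `ν` is unique). -/
def xDeriv (μ : Measure (ℝ × ℝ)) : SignedMeasure (ℝ × ℝ) := Classical.epsilon (IsXDeriv μ)

/-- The Radon-Nikodym density `dμ_{,x}/dμ`. -/
def xDensity (μ : Measure (ℝ × ℝ)) : ℝ × ℝ → ℝ := (xDeriv μ).rnDeriv μ

/-- The class `M_∞` of finite positive measures on `(-1,1) × ℝ` that vanish on `(-1,0] × ℝ`, whose
distributional `x`-derivative is a bounded measure absolutely continuous with respect to `μ`, and
that satisfy `∫_{(0,1)×ℝ} φ(x) dμ = ∫_0^1 2 x φ(x) dx` for all `φ ∈ C_c^∞(0,1)`. -/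
structure MemMInfty (μ : Measure (ℝ × ℝ)) : Prop where
  isFinite : IsFiniteMeasure μ
  concentrated : μ stripᶜ = 0
  vanishes_left : μ (Ioc (-1) 0 ×ˢ univ) = 0
  exists_xDeriv : ∃ ν, IsXDeriv μ ν
  absolutelyContinuous : xDeriv μ ≪ᵥ μ.toENNRealVectorMeasure
  constraint : ∀ φ : ℝ → ℝ, IsTestFunction (Ioo 0 1) φ →
    ∫ p in halfStrip, φ p.1 ∂μ = ∫ x in Ioo (0 : ℝ) 1, 2 * x * φ x

/-- The integrand `(dμ_{,x}/dμ)² / (4 k²)` at `p = (x, k)`, as an element of `[0, ∞]`: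
for `k = 0` it is `∞` where the density is nonzero and `0` where the density vanishes. -/
def tensionDensity (μ : Measure (ℝ × ℝ)) (p : ℝ × ℝ) : ℝ≥0∞ :=
  ENNReal.ofReal (xDensity μ p ^ 2) / ENNReal.ofReal (4 * p.2 ^ 2)

/-- The functional `F_∞(μ) = ∫_{(0,1)×ℝ} [k² + (dμ_{,x}/dμ)² / (4 k²)] dμ ∈ [0, ∞]`. -/
def FInfty (μ : Measure (ℝ × ℝ)) : ℝ≥0∞ :=
  ∫⁻ p in halfStrip, (ENNReal.ofReal (p.2 ^ 2) + tensionDensity μ p) ∂μ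

/-- `μ` minimizes `F_∞` on `M_∞`. -/
def IsMinimizer (μ : Measure (ℝ × ℝ)) : Prop :=
  MemMInfty μ ∧ ∀ μ', MemMInfty μ' → FInfty μ ≤ FInfty μ'

end WrinkleLimit

end

/-!
The equality is a virial identity. The dilations `(x, k) ↦ (x, c k)` map `M_∞` to itself: they do
not touch `x`, so they preserve the `x`-marginal and carry the density of the `x`-derivative along
(`MemMInfty.map_dilation`). If `A` and `B` are the two parts of the energy of `μ`, the dilated
measure has energy `c² A + c⁻² B` (`FInfty_map_dilation`). For a minimizer with `A + B < ∞` this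
expression is minimal at `c = 1`, and stationarity in `c²` gives `A = B` (`eq_of_forall_add_le`).

Finiteness of the minimum requires an admissible measure of finite energy. The marginal `2 x` must
be reached from zero mass at `x = 0`; since the density
`dμ_{,x}/dμ` is then of order `1 / x`, the cost `(dμ_{,x}/dμ)² / (4 k²)` can only be integrable
against `2 x dx` if `k` is large near `x = 0`. The choice `k ∼ x^(-1/2)`
balances both terms: the density `4 x³ k³ exp(-x k²)` on `(0,1) × (0,∞)` has marginal `2 x`, and
each part of its energy, integrated in `k`, is a bounded function of `x`
(`memMInfty_competitor`, `FInfty_competitor_lt_top`).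

Signed measures are only met through `memMInfty_of_density` and `MemMInfty.integral_xDensity_mul`,
which translate membership in `M_∞` into an integration by parts formula with a density.
-/

noncomputable section

namespace WrinkleLimit

/-! ### Derivatives with a density -/

/-- The integral against `g μ` is computed by integrating against `μ`; this identifies
`signedIntegral`, defined through the Jordan decomposition, for signed measures with a density. -/
theorem signedIntegral_withDensityᵥ {μ : Measure (ℝ × ℝ)} {g φ : ℝ × ℝ → ℝ}
    (hg : Measurable g) (hgi : Integrable g μ) (hφ : Continuous φ) (hφc : HasCompactSupport φ) :
    signedIntegral (μ.withDensityᵥ g) φ = ∫ p, g p * φ p ∂μ := by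
  have hJ := SignedMeasure.toJordanDecomposition_eq_of_eq_add_withDensity
    (s := μ.withDensityᵥ g) (t := 0) hg hgi VectorMeasure.MutuallySingular.zero_left
    (zero_add _).symm
  obtain ⟨C, hC⟩ := hφc.exists_bound_of_continuous hφ
  have bdd : ∀ {w : ℝ × ℝ → ℝ}, Integrable w μ → Integrable (fun z => w z * φ z) μ := fun hw =>
    hw.mul_bdd hφ.aestronglyMeasurable (Filter.Eventually.of_forall hC)
  unfold signedIntegral
  rw [hJ]
  simp only [SignedMeasure.toJordanDecomposition_zero, JordanDecomposition.zero_posPart,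
    JordanDecomposition.zero_negPart, zero_add]
  rw [integral_withDensity_eq_integral_toReal_smul hg.ennreal_ofReal (by simp),
    integral_withDensity_eq_integral_toReal_smul
      (f := fun p => ENNReal.ofReal (-g p)) (by fun_prop) (by simp)]
  simp only [ENNReal.toReal_ofReal', smul_eq_mul]
  rw [← integral_sub (bdd hgi.pos_part) (bdd hgi.neg_part)]
  refine integral_congr_ae (Filter.Eventually.of_forall fun p => ?_)
  simp only
  rw [← sub_mul, max_zero_sub_max_neg_zero_eq_self]

/-- A criterion for membership in `M_∞` that avoids signed measures: it is enough to exhibit a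
density `g` of the `x`-derivative, and `g` is then the Radon-Nikodym density. -/
theorem memMInfty_of_density {μ : Measure (ℝ × ℝ)} {g : ℝ × ℝ → ℝ} [IsFiniteMeasure μ]
    (hconc : μ stripᶜ = 0) (hleft : μ (Ioc (-1) 0 ×ˢ univ) = 0)
    (hconstr : ∀ φ : ℝ → ℝ, IsTestFunction (Ioo 0 1) φ →
      ∫ p in halfStrip, φ p.1 ∂μ = ∫ x in Ioo (0 : ℝ) 1, 2 * x * φ x)
    (hg : Measurable g) (hgi : Integrable g μ)
    (hderiv : ∀ φ : ℝ × ℝ → ℝ, IsTestFunction strip φ →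
      ∫ p, g p * φ p ∂μ = -∫ p in strip, deriv (fun t => φ (t, p.2)) p.1 ∂μ) :
    MemMInfty μ ∧ g =ᵐ[μ] xDensity μ := by
  have hx : IsXDeriv μ (μ.withDensityᵥ g) := by
    refine ⟨fun s hs hd => ?_, fun φ hφ => ?_⟩
    · rw [withDensityᵥ_apply hgi hs]
      exact setIntegral_measure_zero _ (measure_mono_null hd.subset_compl_right hconc)
    · rw [signedIntegral_withDensityᵥ hg hgi hφ.contDiff.continuous hφ.hasCompactSupport]
      exact hderiv φ hφ
  have hxe : xDeriv μ = μ.withDensityᵥ g :=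
    IsXDeriv.unique (Classical.epsilon_spec (p := IsXDeriv μ) ⟨_, hx⟩) hx
  refine ⟨⟨inferInstance, hconc, hleft, ⟨_, hx⟩, ?_, hconstr⟩, ?_⟩
  · rw [hxe]
    exact μ.withDensityᵥ_absolutelyContinuous g
  · exact SignedMeasure.eq_rnDeriv 0 g hgi VectorMeasure.MutuallySingular.zero_left
      (by rw [hxe, zero_add])

theorem measurable_xDensity (μ : Measure (ℝ × ℝ)) : Measurable (xDensity μ) :=
  SignedMeasure.measurable_rnDeriv _ _

theorem integrable_xDensity (μ : Measure (ℝ × ℝ)) : Integrable (xDensity μ) μ :=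
  SignedMeasure.integrable_rnDeriv _ _

/-- The defining identity of the distributional derivative, written with its density. -/
theorem MemMInfty.integral_xDensity_mul {μ : Measure (ℝ × ℝ)} (h : MemMInfty μ)
    {φ : ℝ × ℝ → ℝ} (hφ : IsTestFunction strip φ) :
    ∫ p, xDensity μ p * φ p ∂μ = -∫ p in strip, deriv (fun t => φ (t, p.2)) p.1 ∂μ := by
  have := h.isFinite
  have hx : IsXDeriv μ (xDeriv μ) := Classical.epsilon_spec h.exists_xDeriv
  have hd : μ.withDensityᵥ (xDensity μ) = xDeriv μ :=
    SignedMeasure.withDensityᵥ_rnDeriv_eq _ _ h.absolutelyContinuous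
  rw [← hx.integral_eq φ hφ, ← hd]
  exact (signedIntegral_withDensityᵥ (measurable_xDensity μ) (integrable_xDensity μ)
    hφ.contDiff.continuous hφ.hasCompactSupport).symm

/-! ### Dilations in `k` -/

/-- The dilation `(x, k) ↦ (x, c k)`. -/
def dilation (c : ℝ) (hc : c ≠ 0) : (ℝ × ℝ) ≃ₜ (ℝ × ℝ) :=
  (Homeomorph.refl ℝ).prodCongr (Homeomorph.mulLeft₀ c hc)

@[simp]
theorem dilation_apply (c : ℝ) (hc : c ≠ 0) (p : ℝ × ℝ) : dilation c hc p = (p.1, c * p.2) := rfl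

theorem IsTestFunction.comp_dilation {φ : ℝ × ℝ → ℝ} (hφ : IsTestFunction strip φ) (c : ℝ)
    (hc : c ≠ 0) : IsTestFunction strip (φ ∘ dilation c hc) := by
  refine ⟨hφ.contDiff.comp ?_, hφ.hasCompactSupport.comp_homeomorph _, ?_⟩
  · exact contDiff_fst.prodMk (contDiff_const.mul contDiff_snd)
  · intro p hp
    have : p ∈ dilation c hc ⁻¹' tsupport φ :=
      tsupport_comp_subset_preimage φ (dilation c hc).continuous hp
    have h := hφ.tsupport_subset this
    simpa [strip] using h

/-- `M_∞` is invariant under dilations in `k`, and the density of the `x`-derivative is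
transported along. -/
theorem MemMInfty.map_dilation {μ : Measure (ℝ × ℝ)} (h : MemMInfty μ) (c : ℝ) (hc : c ≠ 0) :
    MemMInfty (μ.map (dilation c hc)) ∧
      ∀ᵐ p ∂μ, xDensity (μ.map (dilation c hc)) (dilation c hc p) = xDensity μ p := by
  have := h.isFinite
  set S := dilation c hc with hS
  have hSm : Measurable S := S.measurable
  have hSe : MeasurableEmbedding S := S.measurableEmbedding
  have : IsFiniteMeasure (μ.map S) := inferInstance
  suffices H : MemMInfty (μ.map S) ∧ xDensity μ ∘ S.symm =ᵐ[μ.map S] xDensity (μ.map S) by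
    refine ⟨H.1, ?_⟩
    filter_upwards [ae_of_ae_map hSm.aemeasurable H.2] with p hp
    rw [← hp]
    simp
  refine memMInfty_of_density ?_ ?_ ?_ ((measurable_xDensity μ).comp S.symm.measurable) ?_ ?_
  · rw [hSe.map_apply]
    exact measure_mono_null (fun p hp => by simpa [strip, hS] using hp) h.concentrated
  · rw [hSe.map_apply]
    exact measure_mono_null (fun p hp => by simpa [hS] using hp) h.vanishes_left
  · intro φ hφ
    rw [hSe.setIntegral_map, ← h.constraint φ hφ]
    have : S ⁻¹' halfStrip = halfStrip := by ext p; simp [halfStrip, hS]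
    rw [this]
    rfl
  · rw [hSe.integrable_map_iff]
    refine (integrable_xDensity μ).congr (Filter.Eventually.of_forall fun p => ?_)
    simp
  · intro φ hφ
    rw [hSe.integral_map, hSe.setIntegral_map]
    have hpre : S ⁻¹' strip = strip := by ext p; simp [strip, hS]
    have := h.integral_xDensity_mul (hφ.comp_dilation c hc)
    rw [hpre]
    simp only [Function.comp_apply, S.symm_apply_apply]
    exact this

/-- Under a dilation by `c` the two parts of the energy scale by `c²` and `c⁻²`. -/
theorem FInfty_map_dilation {μ : Measure (ℝ × ℝ)} (h : MemMInfty μ) (c : ℝ) (hc : c ≠ 0) :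
    FInfty (μ.map (dilation c hc)) =
      ENNReal.ofReal (c ^ 2) * (∫⁻ p in halfStrip, ENNReal.ofReal (p.2 ^ 2) ∂μ) +
        (ENNReal.ofReal (c ^ 2))⁻¹ * ∫⁻ p in halfStrip, tensionDensity μ p ∂μ := by
  have hc2 : 0 < c ^ 2 := by positivity
  have hSe := (dilation c hc).measurableEmbedding
  have hpre : dilation c hc ⁻¹' halfStrip = halfStrip := by ext p; simp [halfStrip]
  have hmk : Measurable fun p : ℝ × ℝ => ENNReal.ofReal (p.2 ^ 2) := by fun_prop
  unfold FInfty
  rw [hSe.restrict_map, hSe.lintegral_map, hpre, ← lintegral_const_mul _ hmk,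
    ← lintegral_const_mul' _ _ (by simpa using hc), ← lintegral_add_left (hmk.const_mul _)]
  refine lintegral_congr_ae ?_
  filter_upwards [ae_restrict_of_ae (h.map_dilation c hc).2] with p hp
  unfold tensionDensity
  rw [hp]
  simp only [dilation_apply]
  congr 1
  · rw [mul_pow, ENNReal.ofReal_mul hc2.le]
  · rw [show 4 * (c * p.2) ^ 2 = c ^ 2 * (4 * p.2 ^ 2) by ring, ENNReal.ofReal_mul hc2.le,
      div_eq_mul_inv, ENNReal.mul_inv (by simp [hc]) (by simp), div_eq_mul_inv]
    ring

/-! ### A competitor of finite energy -/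

theorem integral_pow_mul_exp_neg_mul_sq {x : ℝ} (hx : 0 < x) (n : ℕ) :
    ∫ k in Ioi (0 : ℝ), k ^ (2 * n + 1) * Real.exp (-x * k ^ 2) =
      n.factorial / (2 * x ^ (n + 1)) := by
  have h := _root_.integral_rpow_mul_exp_neg_mul_rpow (p := 2) (q := 2 * n + 1) (b := x)
    two_pos (by linarith [n.cast_nonneg (α := ℝ)]) hx
  have e : ((2 * n + 1 : ℝ) + 1) / 2 = n + 1 := by ring
  rw [neg_div, e, Real.Gamma_nat_eq_factorial, Real.rpow_neg hx.le] at h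
  have e' : x ^ ((n : ℝ) + 1) = x ^ (n + 1) := by exact_mod_cast Real.rpow_natCast x (n + 1)
  rw [e'] at h
  have e2 : ∀ k : ℝ, k ^ (2 * (n : ℝ) + 1) = k ^ (2 * n + 1) := fun k => by
    exact_mod_cast Real.rpow_natCast k (2 * n + 1)
  simp only [e2, Real.rpow_two] at h
  rw [h]
  field_simp

theorem integrableOn_pow_mul_exp_neg_mul_sq {x : ℝ} (hx : 0 < x) (n : ℕ) :
    IntegrableOn (fun k : ℝ => k ^ n * Real.exp (-x * k ^ 2)) (Ioi 0) := by
  have h := integrableOn_rpow_mul_exp_neg_mul_sq hx (s := n)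
    (by linarith [n.cast_nonneg (α := ℝ)])
  simpa only [Real.rpow_natCast] using h

theorem lintegral_pow_mul_exp_neg_mul_sq {x : ℝ} (hx : 0 < x) (n : ℕ) :
    ∫⁻ k in Ioi (0 : ℝ), ENNReal.ofReal (k ^ (2 * n + 1) * Real.exp (-x * k ^ 2)) =
      ENNReal.ofReal (n.factorial / (2 * x ^ (n + 1))) := by
  rw [← integral_pow_mul_exp_neg_mul_sq hx n,
    ofReal_integral_eq_lintegral_ofReal (integrableOn_pow_mul_exp_neg_mul_sq hx _)]
  filter_upwards [ae_restrict_mem measurableSet_Ioi] with k hk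
  have : 0 < k := hk
  positivity

/-- The base measure of the competitor: Lebesgue measure on `(0,1) × (0,⊤)`. -/
def baseMeasure : Measure (ℝ × ℝ) :=
  (volume.restrict (Ioo (0 : ℝ) 1)).prod (volume.restrict (Ioi (0 : ℝ)))

/-- The density of the competitor. The typical `k` at `x` is of order `x^(-1/2)`, which makes
both parts of the energy have bounded density in `x`. -/
def profile (p : ℝ × ℝ) : ℝ := 4 * p.1 ^ 3 * p.2 ^ 3 * Real.exp (-p.1 * p.2 ^ 2)

/-- The competitor. -/
def competitor : Measure (ℝ × ℝ) := baseMeasure.withDensity fun p => ENNReal.ofReal (profile p)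

/-- The logarithmic `x`-derivative of `profile`. -/
def profileSlope (p : ℝ × ℝ) : ℝ := 3 / p.1 - p.2 ^ 2

theorem measurable_profile : Measurable profile := by unfold profile; fun_prop

theorem measurable_profileSlope : Measurable profileSlope := by unfold profileSlope; fun_prop

theorem baseMeasure_eq_restrict : baseMeasure = volume.restrict (Ioo (0 : ℝ) 1 ×ˢ Ioi (0 : ℝ)) :=
  Measure.prod_restrict _ _

instance : SFinite baseMeasure := by unfold baseMeasure; infer_instance

theorem ae_baseMeasure : ∀ᵐ p ∂baseMeasure, p.1 ∈ Ioo (0 : ℝ) 1 ∧ 0 < p.2 := by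
  rw [baseMeasure_eq_restrict]
  filter_upwards [ae_restrict_mem (measurableSet_Ioo.prod measurableSet_Ioi)] with p hp
  exact hp

theorem ae_competitor : ∀ᵐ p ∂competitor, p.1 ∈ Ioo (0 : ℝ) 1 ∧ 0 < p.2 :=
  (withDensity_absolutelyContinuous _ _).ae_le ae_baseMeasure

theorem profile_nonneg {p : ℝ × ℝ} (hp : p.1 ∈ Ioo (0 : ℝ) 1 ∧ 0 < p.2) : 0 ≤ profile p := by
  have := hp.1.1
  have := hp.2
  unfold profile
  positivity

theorem lintegral_competitor (h : ℝ × ℝ → ℝ≥0∞) :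
    ∫⁻ p, h p ∂competitor = ∫⁻ p, ENNReal.ofReal (profile p) * h p ∂baseMeasure := by
  unfold competitor
  rw [lintegral_withDensity_eq_lintegral_mul_non_measurable _ measurable_profile.ennreal_ofReal
    (by simp)]
  rfl

theorem integral_competitor (h : ℝ × ℝ → ℝ) :
    ∫ p, h p ∂competitor = ∫ p, profile p * h p ∂baseMeasure := by
  unfold competitor
  rw [integral_withDensity_eq_integral_toReal_smul measurable_profile.ennreal_ofReal (by simp)]
  refine integral_congr_ae ?_
  filter_upwards [ae_baseMeasure] with p hp
  rw [ENNReal.toReal_ofReal (profile_nonneg hp), smul_eq_mul]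

theorem integrable_competitor {h : ℝ × ℝ → ℝ} :
    Integrable h competitor ↔ Integrable (fun p => profile p * h p) baseMeasure := by
  unfold competitor
  rw [integrable_withDensity_iff_integrable_smul' measurable_profile.ennreal_ofReal (by simp)]
  refine integrable_congr ?_
  filter_upwards [ae_baseMeasure] with p hp
  rw [ENNReal.toReal_ofReal (profile_nonneg hp), smul_eq_mul]

/-- Moments `x^m k^(2n+1) exp(-x k²)` with `m ≥ n + 1` have finite integral: integration in `k`
leaves a multiple of `x^(m-n-1)`, which is bounded on `(0,1)`. -/
theorem lintegral_moment_lt_top {m n : ℕ} (hmn : n + 1 ≤ m) :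
    ∫⁻ p, ENNReal.ofReal (p.1 ^ m * p.2 ^ (2 * n + 1) * Real.exp (-p.1 * p.2 ^ 2)) ∂baseMeasure
      < ⊤ := by
  have hm : Measurable fun p : ℝ × ℝ =>
      ENNReal.ofReal (p.1 ^ m * p.2 ^ (2 * n + 1) * Real.exp (-p.1 * p.2 ^ 2)) := by fun_prop
  unfold baseMeasure
  rw [lintegral_prod _ hm.aemeasurable]
  calc _ ≤ ∫⁻ x in Ioo (0 : ℝ) 1, ENNReal.ofReal n.factorial := by
        refine setLIntegral_mono measurable_const fun x hx => ?_
        have hx0 : 0 < x := hx.1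
        simp_rw [mul_assoc, ENNReal.ofReal_mul (pow_nonneg hx0.le m)]
        rw [lintegral_const_mul _ (by fun_prop), lintegral_pow_mul_exp_neg_mul_sq hx0,
          ← ENNReal.ofReal_mul (by positivity)]
        refine ENNReal.ofReal_le_ofReal ?_
        rw [← mul_div_assoc, div_le_iff₀ (by positivity), mul_comm]
        have h1 : x ^ m ≤ x ^ (n + 1) := pow_le_pow_of_le_one hx0.le hx.2.le hmn
        have h2 : 0 < x ^ (n + 1) := by positivity
        gcongr
        linarith
    _ < ⊤ := by simp

theorem integrable_moment {m n : ℕ} (hmn : n + 1 ≤ m) :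
    Integrable (fun p : ℝ × ℝ => p.1 ^ m * p.2 ^ (2 * n + 1) * Real.exp (-p.1 * p.2 ^ 2))
      baseMeasure := by
  refine ⟨by fun_prop, (hasFiniteIntegral_iff_ofReal ?_).2 (lintegral_moment_lt_top hmn)⟩
  filter_upwards [ae_baseMeasure] with p hp
  have := hp.1.1
  have := hp.2
  simp only [Pi.zero_apply]
  positivity

theorem integrable_profile : Integrable profile baseMeasure := by
  refine ((integrable_moment (m := 3) (n := 1) (by norm_num)).const_mul 4).congr ?_
  refine Filter.Eventually.of_forall fun p => ?_
  simp only [profile]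
  ring

instance : IsFiniteMeasure competitor := by
  have := integrable_competitor (h := fun _ => 1)
  simp only [mul_one] at this
  rw [integrable_const_iff] at this
  simpa using this.2 integrable_profile

theorem profile_mul_profileSlope {p : ℝ × ℝ} (hp : p.1 ≠ 0) :
    profile p * profileSlope p =
      4 * p.2 ^ 3 * (3 * p.1 ^ 2 - p.2 ^ 2 * p.1 ^ 3) * Real.exp (-p.1 * p.2 ^ 2) := by
  unfold profile profileSlope
  field_simp

theorem integrable_profileSlope : Integrable profileSlope competitor := by
  rw [integrable_competitor]
  refine (((integrable_moment (m := 2) (n := 1) le_rfl).const_mul 12).sub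
    ((integrable_moment (m := 3) (n := 2) le_rfl).const_mul 4)).congr ?_
  filter_upwards [ae_baseMeasure] with p hp
  rw [profile_mul_profileSlope hp.1.1.ne']
  simp only [Pi.sub_apply]
  ring

/-- The energy density of the competitor with respect to `baseMeasure` is bounded by the moments
`x k exp(-x k²)` and `x³ k⁵ exp(-x k²)`. -/
theorem profile_mul_energy_le {p : ℝ × ℝ} (hp : p.1 ∈ Ioo (0 : ℝ) 1 ∧ 0 < p.2) :
    ENNReal.ofReal (profile p) *
        (ENNReal.ofReal (p.2 ^ 2) +
          ENNReal.ofReal (profileSlope p ^ 2) / ENNReal.ofReal (4 * p.2 ^ 2)) ≤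
      ENNReal.ofReal (9 * (p.1 ^ 1 * p.2 ^ (2 * 0 + 1) * Real.exp (-p.1 * p.2 ^ 2))) +
        ENNReal.ofReal (5 * (p.1 ^ 3 * p.2 ^ (2 * 2 + 1) * Real.exp (-p.1 * p.2 ^ 2))) := by
  obtain ⟨x, k⟩ := p
  obtain ⟨⟨hx, -⟩, hk⟩ := hp
  simp only at hx hk ⊢
  rw [← ENNReal.ofReal_div_of_pos (by positivity), ← ENNReal.ofReal_add (by positivity)
    (by positivity), ← ENNReal.ofReal_mul (by unfold profile; positivity),
    ← ENNReal.ofReal_add (by positivity) (by positivity)]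
  refine ENNReal.ofReal_le_ofReal ?_
  unfold profile profileSlope
  -- The cross term of the square is nonpositive and is dropped.
  have e : 4 * x ^ 3 * k ^ 3 * Real.exp (-x * k ^ 2) * (k ^ 2 + (3 / x - k ^ 2) ^ 2 / (4 * k ^ 2)) =
      (9 * x * k - 6 * x ^ 2 * k ^ 3 + 5 * x ^ 3 * k ^ 5) * Real.exp (-x * k ^ 2) := by
    field_simp
    ring
  simp only
  rw [e]
  have : 0 ≤ 6 * x ^ 2 * k ^ 3 * Real.exp (-x * k ^ 2) := by positivity
  have e' : 9 * (x ^ 1 * k ^ (2 * 0 + 1) * Real.exp (-x * k ^ 2)) +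
      5 * (x ^ 3 * k ^ (2 * 2 + 1) * Real.exp (-x * k ^ 2)) =
      (9 * x * k - 6 * x ^ 2 * k ^ 3 + 5 * x ^ 3 * k ^ 5) * Real.exp (-x * k ^ 2) +
        6 * x ^ 2 * k ^ 3 * Real.exp (-x * k ^ 2) := by ring
  rw [e']
  exact le_add_of_nonneg_right this

/-- Slicing at fixed `k` and integrating by parts in `x` over `(0,1)`. The boundary terms vanish
because `profile` is zero at `x = 0` and `φ` is zero at `x = 1`. -/
theorem integral_profile_mul_profileSlope_mul {φ : ℝ × ℝ → ℝ} (hφ : IsTestFunction strip φ)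
    (k : ℝ) :
    ∫ x in Ioo (0 : ℝ) 1, profile (x, k) * (profileSlope (x, k) * φ (x, k)) =
      -∫ x in Ioo (0 : ℝ) 1, profile (x, k) * deriv (fun t => φ (t, k)) x := by
  have hc : ContDiff ℝ ∞ fun t => φ (t, k) := hφ.contDiff.comp (contDiff_prodMk_left k)
  have h1 : φ (1, k) = 0 := by
    by_contra h
    have := hφ.tsupport_subset (subset_tsupport φ (Function.mem_support.2 h))
    simp [strip] at this
  have hu : ∀ x : ℝ, HasDerivAt (fun t => profile (t, k))
      (4 * k ^ 3 * (3 * x ^ 2 - k ^ 2 * x ^ 3) * Real.exp (-x * k ^ 2)) x := by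
    intro x
    unfold profile
    have h := ((((hasDerivAt_pow 3 x).const_mul 4).mul_const (k ^ 3)).mul
      (((hasDerivAt_id x).neg.mul_const (k ^ 2)).exp))
    convert! h using 1
    simp
    ring
  have hbp := intervalIntegral.integral_mul_deriv_eq_deriv_mul (a := 0) (b := 1)
    (fun x _ => hu x) (fun x _ => (hc.differentiable (by simp) x).hasDerivAt)
    (by apply Continuous.intervalIntegrable; fun_prop)
    ((hc.continuous_deriv (by simp)).intervalIntegrable _ _)
  rw [h1, show profile (0, k) = 0 by simp [profile], mul_zero, zero_mul, sub_zero, zero_sub,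
    intervalIntegral.integral_of_le zero_le_one, intervalIntegral.integral_of_le zero_le_one,
    integral_Ioc_eq_integral_Ioo, integral_Ioc_eq_integral_Ioo] at hbp
  rw [hbp, neg_neg]
  refine setIntegral_congr_fun measurableSet_Ioo fun x hx => ?_
  rw [← mul_assoc, profile_mul_profileSlope hx.1.ne']

/-- The competitor is admissible: integrating out `k` turns `profile` into `2 x`, and its
`x`-derivative has density `profileSlope`. -/
theorem memMInfty_competitor : MemMInfty competitor ∧ profileSlope =ᵐ[competitor]
    xDensity competitor := by
  have hstrip : ∀ᵐ p ∂competitor, p ∈ strip := by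
    filter_upwards [ae_competitor] with p hp
    have := hp.1.1
    have := hp.1.2
    simp only [strip, mem_prod, mem_Ioo, mem_univ, and_true]
    constructor <;> linarith
  have hhalf : ∀ᵐ p ∂competitor, p ∈ halfStrip := by
    filter_upwards [ae_competitor] with p hp
    exact ⟨hp.1, mem_univ _⟩
  refine memMInfty_of_density hstrip ?_ ?_ measurable_profileSlope integrable_profileSlope ?_
  · rw [measure_eq_zero_iff_ae_notMem]
    filter_upwards [ae_competitor] with p hp hp'
    exact absurd hp.1.1 (not_lt.2 hp'.1.2)
  · intro φ hφ
    obtain ⟨C, hC⟩ := hφ.hasCompactSupport.exists_bound_of_continuous hφ.contDiff.continuous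
    have hφm := hφ.contDiff.continuous
    have hi : Integrable (fun p => profile p * φ p.1) baseMeasure :=
      integrable_profile.mul_bdd (c := C) (by fun_prop)
        (Filter.Eventually.of_forall fun p => hC p.1)
    rw [Measure.restrict_eq_self_of_ae_mem hhalf, integral_competitor]
    unfold baseMeasure at hi ⊢
    rw [integral_prod _ hi]
    refine setIntegral_congr_fun measurableSet_Ioo fun x hx => ?_
    have hx0 : 0 < x := hx.1
    have e : ∀ k, profile (x, k) * φ x =
        4 * x ^ 3 * φ x * (k ^ (2 * 1 + 1) * Real.exp (-x * k ^ 2)) := fun k => by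
      simp only [profile]; ring
    simp only [e]
    rw [integral_const_mul, integral_pow_mul_exp_neg_mul_sq hx0]
    simp only [Nat.factorial]
    field_simp
    norm_num
    ring
  · intro φ hφ
    obtain ⟨C, hC⟩ := hφ.hasCompactSupport.exists_bound_of_continuous hφ.contDiff.continuous
    -- The partial derivative is continuous with compact support, hence bounded.
    have hd : ∀ p : ℝ × ℝ, deriv (fun t => φ (t, p.2)) p.1 = fderiv ℝ φ p (1, 0) := by
      intro p
      have h1 : HasDerivAt (fun t : ℝ => (t, p.2)) ((1 : ℝ), (0 : ℝ)) p.1 :=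
        (hasDerivAt_id _).prodMk (hasDerivAt_const _ _)
      exact (((hφ.contDiff.differentiable (by simp) p).hasFDerivAt).comp_hasDerivAt p.1 h1).deriv
    have hdc : Continuous fun p : ℝ × ℝ => fderiv ℝ φ p (1, 0) :=
      (hφ.contDiff.continuous_fderiv (by simp)).clm_apply continuous_const
    obtain ⟨D, hD⟩ := (hφ.hasCompactSupport.fderiv_apply (𝕜 := ℝ) (1, 0)).exists_bound_of_continuous
      hdc
    have hi : Integrable (fun p => profile p * (profileSlope p * φ p)) baseMeasure := by
      rw [← integrable_competitor]
      exact integrable_profileSlope.mul_bdd hφ.contDiff.continuous.aestronglyMeasurable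
        (Filter.Eventually.of_forall hC)
    have hi' : Integrable (fun p => profile p * deriv (fun t => φ (t, p.2)) p.1) baseMeasure := by
      simp only [hd]
      exact integrable_profile.mul_bdd hdc.aestronglyMeasurable (Filter.Eventually.of_forall hD)
    rw [Measure.restrict_eq_self_of_ae_mem hstrip, integral_competitor, integral_competitor]
    unfold baseMeasure at hi hi' ⊢
    rw [integral_prod_symm _ hi, integral_prod_symm _ hi', ← integral_neg]
    exact integral_congr_ae (Filter.Eventually.of_forall fun k =>
      integral_profile_mul_profileSlope_mul hφ k)

theorem FInfty_competitor_lt_top : FInfty competitor < ⊤ := by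
  calc FInfty competitor
      ≤ ∫⁻ p, (ENNReal.ofReal (p.2 ^ 2) + tensionDensity competitor p) ∂competitor :=
        setLIntegral_le_lintegral _ _
    _ = ∫⁻ p, (ENNReal.ofReal (p.2 ^ 2) +
          ENNReal.ofReal (profileSlope p ^ 2) / ENNReal.ofReal (4 * p.2 ^ 2)) ∂competitor := by
        refine lintegral_congr_ae ?_
        filter_upwards [memMInfty_competitor.2] with p hp
        rw [tensionDensity, hp]
    _ ≤ ∫⁻ p, (ENNReal.ofReal (9 * (p.1 ^ 1 * p.2 ^ (2 * 0 + 1) * Real.exp (-p.1 * p.2 ^ 2))) +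
          ENNReal.ofReal (5 * (p.1 ^ 3 * p.2 ^ (2 * 2 + 1) * Real.exp (-p.1 * p.2 ^ 2))))
          ∂baseMeasure := by
        rw [lintegral_competitor]
        refine lintegral_mono_ae ?_
        filter_upwards [ae_baseMeasure] with p hp
        exact profile_mul_energy_le hp
    _ < ⊤ := by
        rw [lintegral_add_left (by fun_prop)]
        have h5 : (0 : ℝ) ≤ 5 := by norm_num
        have h9 : (0 : ℝ) ≤ 9 := by norm_num
        simp_rw [ENNReal.ofReal_mul h5, ENNReal.ofReal_mul h9]
        rw [lintegral_const_mul _ (by fun_prop), lintegral_const_mul _ (by fun_prop)]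
        exact ENNReal.add_lt_top.2
          ⟨ENNReal.mul_lt_top ENNReal.ofReal_lt_top (lintegral_moment_lt_top le_rfl),
            ENNReal.mul_lt_top ENNReal.ofReal_lt_top (lintegral_moment_lt_top le_rfl)⟩

/-! ### Balance of the two energies -/

/-- Stationarity of `t ↦ t a + t⁻¹ b` at `t = 1` forces `a = b`. -/
theorem eq_of_forall_add_le {a b : ℝ} (h : ∀ c : ℝ, 0 < c → a + b ≤ c ^ 2 * a + (c ^ 2)⁻¹ * b) :
    a = b := by
  have hmin : IsLocalMin (fun t : ℝ => t * a + t⁻¹ * b) 1 := by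
    filter_upwards [lt_mem_nhds (zero_lt_one' ℝ)] with t ht
    have := h (Real.sqrt t) (Real.sqrt_pos.2 ht)
    rw [Real.sq_sqrt ht.le] at this
    simpa using this
  have hd : HasDerivAt (fun t : ℝ => t * a + t⁻¹ * b) (a - b) 1 := by
    have := ((hasDerivAt_id (1 : ℝ)).mul_const a).add ((hasDerivAt_inv one_ne_zero).mul_const b)
    convert! this using 1
    norm_num
    ring
  exact sub_eq_zero.1 (hmin.hasDerivAt_eq_zero hd)

end WrinkleLimit

end

theorem corollary6p3 (μ : MeasureTheory.Measure (ℝ × ℝ)) (hμ : WrinkleLimit.IsMinimizer μ) :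
    (∫⁻ p in WrinkleLimit.halfStrip, ENNReal.ofReal (p.2 ^ 2) ∂μ) =
        (∫⁻ p in WrinkleLimit.halfStrip, WrinkleLimit.tensionDensity μ p ∂μ) ∧
      (∫⁻ p in WrinkleLimit.halfStrip, ENNReal.ofReal (p.2 ^ 2) ∂μ) < ⊤ := by
  obtain ⟨hmem, hmin⟩ := hμ
  have hF : WrinkleLimit.FInfty μ < ⊤ :=
    (hmin _ WrinkleLimit.memMInfty_competitor.1).trans_lt WrinkleLimit.FInfty_competitor_lt_top
  have hadd : WrinkleLimit.FInfty μ =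
      (∫⁻ p in WrinkleLimit.halfStrip, ENNReal.ofReal (p.2 ^ 2) ∂μ) +
        ∫⁻ p in WrinkleLimit.halfStrip, WrinkleLimit.tensionDensity μ p ∂μ :=
    lintegral_add_left (by fun_prop) _
  -- Comparing `μ` with its dilations in `k`.
  have hscale : ∀ c : ℝ, 0 < c → _ := fun c hc =>
    (hmin _ (hmem.map_dilation c hc.ne').1).trans_eq
      (WrinkleLimit.FInfty_map_dilation hmem c hc.ne')
  rw [hadd] at hF hscale
  obtain ⟨hA, hB⟩ := ENNReal.add_lt_top.1 hF
  refine ⟨?_, hA⟩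
  generalize (∫⁻ p in WrinkleLimit.halfStrip, ENNReal.ofReal (p.2 ^ 2) ∂μ) = A at *
  generalize (∫⁻ p in WrinkleLimit.halfStrip, WrinkleLimit.tensionDensity μ p ∂μ) = B at *
  lift A to NNReal using hA.ne
  lift B to NNReal using hB.ne
  suffices (A : ℝ) = B by exact_mod_cast this
  refine WrinkleLimit.eq_of_forall_add_le fun c hc => ?_
  have h := hscale c hc
  have hc2 : 0 < c ^ 2 := by positivity
  rw [← ENNReal.ofReal_inv_of_pos hc2] at h
  have h' := ENNReal.toReal_mono (by finiteness) h
  rw [ENNReal.toReal_add (by finiteness) (by finiteness),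
    ENNReal.toReal_add (by finiteness) (by finiteness), ENNReal.toReal_mul, ENNReal.toReal_mul,
    ENNReal.toReal_ofReal hc2.le, ENNReal.toReal_ofReal (by positivity)] at h'
  simpa using h'
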